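/- For a finite set $B\subseteq S_n$ let $\mathcal Q(B)=\sum_{\pi\in B}F_{n,\mathrm{Des}(\pi)}$, where $\mathrm{Des}(\pi)=\{i\in\{1,\dots,n-1\}:\pi(i)>\pi(i+1)\}$ and, for $D\subseteq\{1,\dots,n-1\}$, $$F_{n,D}=\sum_{\substack{i_1\le i_2\le\cdots\le i_n\\ i_j<i_{j+1}\text{ if }j\in D}}x_{i_1}x_{i_2}\cdots x_{i_n}$$ is the fundamental quasisymmetric function. The set $B$ is called Schur-positive if $\mathcal Q(B)$ is a symmetric function whose expansion in the basis of Schur functions $s_\lambda$ has nonnegative coefficients. Theorem. Let $n\ge 2$ and let $A\subseteq S_{n-1}$ be Schur-positive. Identify $S_{n-1}$ with the set of permutations in $S_n$ that fix $n$, let $c=(1,2,\dots,n)$ and $C_n=\langle c\rangle=\{c^k:0\le k<n\}\subseteq S_n$, and let $$AC_n=\{\pi c^k:\pi\in A,\ 0\le k<n\}\subseteq S_n .$$ Then $AC_n$ is Schur-positive, and $$\mathcal Q(AC_n)=\mathcal Q(A)\,s_1,$$ where $\mathcal Q(A)$ is computed regarding $A$ as a subset of $S_{n-1}$. -/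

import Mathlib

namespace HorizontalRotation

/-- A formal power series over `ℚ` in the countably many variables `x 0, x 1, x 2, …`. -/
abbrev Series : Type := MvPowerSeries ℕ ℚ

/-- `f` is a symmetric function: a formal power series of bounded degree whose coefficients are
invariant under all permutations of the variables. -/
def IsSymmetricFunction (f : Series) : Prop :=
  (∃ d : ℕ, ∀ m : ℕ →₀ ℕ, MvPowerSeries.coeff m f ≠ 0 → m.degree ≤ d) ∧
    ∀ (σ : Equiv.Perm ℕ) (m : ℕ →₀ ℕ),
      MvPowerSeries.coeff (m.mapDomain σ) f = MvPowerSeries.coeff m f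

/-! ### Fundamental quasisymmetric functions -/

/-- The index sequences `i_1 ≤ i_2 ≤ … ≤ i_n` with `i_j < i_{j+1}` whenever `j ∈ D`.
The entry `i_j` is stored at the element of `Fin n` of value `j - 1`, so consecutive positions
`a`, `b` of `Fin n` (with `b = a + 1`) correspond to `j = b` and `j + 1`. -/
def admissibleSeqs (n : ℕ) (D : Finset ℕ) : Set (Fin n → ℕ) :=
  {i | Monotone i ∧ ∀ a b : Fin n, (b : ℕ) = (a : ℕ) + 1 → (b : ℕ) ∈ D → i a < i b}

/-- The exponent vector of the monomial `x_{i_1} x_{i_2} ⋯ x_{i_n}`. -/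
noncomputable def seqMonomial {n : ℕ} (i : Fin n → ℕ) : ℕ →₀ ℕ :=
  ∑ j, Finsupp.single (i j) 1

/-- The fundamental quasisymmetric function `F_{n,D}`, for `D ⊆ {1, …, n-1}`: the sum of
`x_{i_1} ⋯ x_{i_n}` over all admissible sequences, so that the coefficient of a monomial is the
number of admissible sequences giving that monomial. -/
noncomputable def fundamental (n : ℕ) (D : Finset ℕ) : Series :=
  fun m => (({i | i ∈ admissibleSeqs n D ∧ seqMonomial i = m} : Set (Fin n → ℕ)).ncard : ℚ)

/-- The set counted in `fundamental` is finite. -/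
theorem finite_seqs (n : ℕ) (D : Finset ℕ) (m : ℕ →₀ ℕ) :
    ({i | i ∈ admissibleSeqs n D ∧ seqMonomial i = m} : Set (Fin n → ℕ)).Finite := by
  refine (Set.Finite.pi' (t := fun _ : Fin n => (m.support : Set ℕ))
    (fun _ => m.support.finite_toSet)).subset ?_
  rintro i ⟨-, rfl⟩ j
  have h : (Finsupp.single (i j) 1 : ℕ →₀ ℕ) (i j) ≤ seqMonomial i (i j) := by
    rw [seqMonomial, Finsupp.finsetSum_apply]
    exact Finset.single_le_sum (f := fun k => (Finsupp.single (i k) 1 : ℕ →₀ ℕ) (i j))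
      (fun _ _ => Nat.zero_le _) (Finset.mem_univ j)
  rw [Finsupp.single_eq_same] at h
  simp only [Finset.mem_coe, Finsupp.mem_support_iff]
  omega

/-! ### Schur functions -/

/-- The exponent vector of the monomial `x^T` of a semistandard Young tableau `T`. -/
noncomputable def tableauMonomial {μ : YoungDiagram} (T : SemistandardYoungTableau μ) : ℕ →₀ ℕ :=
  ∑ c ∈ μ.cells, Finsupp.single (T c.1 c.2) 1

/-- The Schur function `s_μ`, the sum of `x^T` over all semistandard Young tableaux `T` of
shape `μ`: the coefficient of a monomial is the number of tableaux giving that monomial. -/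
noncomputable def schur (μ : YoungDiagram) : Series :=
  fun m => (({T | tableauMonomial T = m} : Set (SemistandardYoungTableau μ)).ncard : ℚ)

/-- The set counted in `schur` is finite. -/
theorem finite_tableaux (μ : YoungDiagram) (m : ℕ →₀ ℕ) :
    ({T | tableauMonomial T = m} : Set (SemistandardYoungTableau μ)).Finite := by
  let g : SemistandardYoungTableau μ → (μ.cells → ℕ) := fun T c => T c.1.1 c.1.2
  have hg : Function.Injective g := by
    intro T T' h
    ext i j
    by_cases hc : (i, j) ∈ μ
    · exact congrFun h ⟨(i, j), (YoungDiagram.mem_cells _).2 hc⟩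
    · rw [T.zeros hc, T'.zeros hc]
  refine Set.Finite.of_finite_image (f := g) ?_ hg.injOn
  refine (Set.Finite.pi' (t := fun _ : μ.cells => (m.support : Set ℕ))
    (fun _ => m.support.finite_toSet)).subset ?_
  rintro _ ⟨T, rfl, rfl⟩ c
  have h : (Finsupp.single (T c.1.1 c.1.2) 1 : ℕ →₀ ℕ) (T c.1.1 c.1.2)
      ≤ tableauMonomial T (T c.1.1 c.1.2) := by
    rw [tableauMonomial, Finsupp.finsetSum_apply]
    exact Finset.single_le_sum
      (f := fun d : ℕ × ℕ => (Finsupp.single (T d.1 d.2) 1 : ℕ →₀ ℕ) (T c.1.1 c.1.2))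
      (fun _ _ => Nat.zero_le _) c.2
  rw [Finsupp.single_eq_same] at h
  simp only [g, Finset.mem_coe, Finsupp.mem_support_iff]
  omega

/-- The Young diagram of the partition `(1)`, with a single cell. -/
def oneBox : YoungDiagram where
  cells := {(0, 0)}
  isLowerSet := by
    intro a b hba ha
    simp only [Finset.coe_singleton, Set.mem_singleton_iff] at ha ⊢
    subst ha
    exact le_antisymm hba (Prod.mk_le_mk.2 ⟨Nat.zero_le _, Nat.zero_le _⟩)

/-! ### Sets of permutations

`Equiv.Perm (Fin n)` is the symmetric group `S_n`; the letter (or position) `i ∈ {1, …, n}` is the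
element of `Fin n` of value `i - 1`. -/

/-- The descent set `{i : 1 ≤ i ≤ n - 1, π(i) > π(i+1)}`: below `a` and `b` are the positions
`i` and `i + 1`. -/
def Des {n : ℕ} (π : Equiv.Perm (Fin n)) : Finset ℕ :=
  {i ∈ Finset.Icc 1 (n - 1) | ∃ a b : Fin n, (a : ℕ) + 1 = i ∧ (b : ℕ) = i ∧ π a > π b}

/-- `Q(B)`, the sum of `F_{n, Des π}` over `π ∈ B`. -/
noncomputable def Q {n : ℕ} (B : Finset (Equiv.Perm (Fin n))) : Series :=
  ∑ π ∈ B, fundamental n (Des π)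

/-- `B` is Schur-positive: `Q(B)` is a symmetric function and its expansion in the basis of Schur
functions has nonnegative coefficients. -/
def SchurPositive {n : ℕ} (B : Finset (Equiv.Perm (Fin n))) : Prop :=
  IsSymmetricFunction (Q B) ∧
    ∃ c : YoungDiagram →₀ ℚ, (∀ μ, 0 ≤ c μ) ∧ Q B = c.sum fun μ a => a • schur μ

/-- The identification of `S_m` with the permutations in `S_{m+1}` that fix the last letter. -/
def embed {m : ℕ} (σ : Equiv.Perm (Fin m)) : Equiv.Perm (Fin (m + 1)) :=
  σ.viaFintypeEmbedding Fin.castSuccEmb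

theorem embed_castSucc {m : ℕ} (σ : Equiv.Perm (Fin m)) (i : Fin m) :
    embed σ i.castSucc = (σ i).castSucc :=
  σ.viaFintypeEmbedding_apply_image Fin.castSuccEmb i

theorem embed_last {m : ℕ} (σ : Equiv.Perm (Fin m)) :
    embed σ (Fin.last m) = Fin.last m := by
  refine σ.viaFintypeEmbedding_apply_notMem_range _ ?_
  rintro ⟨i, hi⟩
  exact Fin.castSucc_ne_last i hi

/-- The cyclic subgroup `C_n = {c^k : 0 ≤ k < n}` of `S_n` generated by the `n`-cycle
`c = (1, 2, …, n)`. -/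
def cyclicGroup (n : ℕ) : Finset (Equiv.Perm (Fin n)) :=
  (Finset.range n).image fun k => finRotate n ^ k

/-- The set `A C_n ⊆ S_n` of horizontal rotations of `A ⊆ S_{n-1}`, where `n = m + 1`. -/
def rotations {m : ℕ} (A : Finset (Equiv.Perm (Fin m))) : Finset (Equiv.Perm (Fin (m + 1))) :=
  Finset.image₂ (fun σ ρ => embed σ * ρ) A (cyclicGroup (m + 1))

end HorizontalRotation

/-!
Only the symmetry of `Q A` is needed for the identity `Q (A C_n) = Q A · s_1`. Take indices
`i_0 ≤ ⋯ ≤ i_{n-1}` with monomial `m`. The coefficient of `m` in `Q B` counts the `π ∈ B` that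
increase along each block of equal indices (`coeff_Q`). Let `π` be the rotation of `σ ∈ A` whose
largest letter stands at position `p`. If `π` is counted, then `p` is the end of a block, since
nothing larger than `π(p)` can follow; and reading `π` cyclically from `p + 1`, stopping before `p`,
gives back the word of `σ`, which increases along the blocks of `i` read in the same cyclic order
with one index `i_p` deleted (`isIncreasingOnFibers_embed_mul_rotTo_iff`). This cyclically rotated
sequence becomes weakly increasing after the variables are permuted, so by symmetry the number of
such `σ` is the coefficient of `m / x_{i_p}` in `Q A`. The block ends `p` correspond to the variables
occurring in `m`, and the sum over them is the coefficient of `m` in `Q A · s_1` (`Q_rotations`).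

A product of symmetric functions is symmetric, so Schur positivity of `A C_n` follows from the Pieri
rule for one box, `s_μ s_1 = ∑ s_κ` over the diagrams `κ` covering `μ` (`schur_mul_schur_oneBox`).
It is proved by induction on the number of variables. The cells of a tableau that carry the largest
entry form a horizontal strip (`card_tableaux_eq_sum`), and the induction step is the commutation
relation between adding a cell and removing a horizontal strip (`card_strips`): with `U` the operator
adding a cell and `D` the one removing strips, weighted by `t` to their size, `D U = U D + t D`.
-/

namespace HorizontalRotation

/-! ### Covers and horizontal strips of Young diagrams -/

theorem le_iff_rowLen {μ ν : YoungDiagram} : μ ≤ ν ↔ ∀ i, μ.rowLen i ≤ ν.rowLen i := by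
  constructor
  · intro h i
    by_contra! hlt
    have h1 : (i, ν.rowLen i) ∈ ν := h (YoungDiagram.mem_iff_lt_rowLen.2 hlt)
    exact lt_irrefl _ (YoungDiagram.mem_iff_lt_rowLen.1 h1)
  · rintro h ⟨i, j⟩ hc
    exact YoungDiagram.mem_iff_lt_rowLen.2 ((YoungDiagram.mem_iff_lt_rowLen.1 hc).trans_le (h i))

theorem eq_of_rowLen {μ ν : YoungDiagram} (h : ∀ i, μ.rowLen i = ν.rowLen i) : μ = ν :=
  le_antisymm (le_iff_rowLen.2 fun i => (h i).le) (le_iff_rowLen.2 fun i => (h i).ge)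

/-- The smallest Young diagram containing `μ` and the cell just past row `i`. It has exactly
one cell more than `μ` when row `i` is strictly shorter than all rows above it. -/
def grow (μ : YoungDiagram) (i : ℕ) : YoungDiagram where
  cells := μ.cells ∪ Finset.Iic (i, μ.rowLen i)
  isLowerSet := by
    rw [Finset.coe_union, Finset.coe_Iic]
    exact μ.isLowerSet.union (isLowerSet_Iic _)

theorem rowLen_grow {μ : YoungDiagram} {i : ℕ} (h : ∀ k < i, μ.rowLen i < μ.rowLen k) (k : ℕ) :
    (grow μ i).rowLen k = μ.rowLen k + if k = i then 1 else 0 := by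
  refine eq_of_forall_lt_iff fun j => ?_
  rw [← YoungDiagram.mem_iff_lt_rowLen, ← YoungDiagram.mem_cells]
  simp only [grow, Finset.mem_union, YoungDiagram.mem_cells, YoungDiagram.mem_iff_lt_rowLen,
    Finset.mem_Iic, Prod.mk_le_mk]
  rcases lt_trichotomy k i with hk | rfl | hk
  · have := h k hk
    rw [if_neg hk.ne]; omega
  · rw [if_pos rfl]; omega
  · rw [if_neg hk.ne']; omega

/-- The largest Young diagram contained in `μ` that avoids the last cell of row `i`. It has exactly
one cell less than `μ` when row `i` is strictly longer than row `i + 1`. -/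
def shrink (μ : YoungDiagram) (i : ℕ) : YoungDiagram where
  cells := {c ∈ μ.cells | ¬ (i, μ.rowLen i - 1) ≤ c}
  isLowerSet := by
    intro a b hba ha
    simp only [Finset.coe_filter, Set.mem_ofPred_eq] at ha ⊢
    exact ⟨μ.isLowerSet hba ha.1, fun h => ha.2 (h.trans hba)⟩

theorem rowLen_shrink {μ : YoungDiagram} {i : ℕ} (h : μ.rowLen (i + 1) < μ.rowLen i) (k : ℕ) :
    (shrink μ i).rowLen k = μ.rowLen k - if k = i then 1 else 0 := by
  refine eq_of_forall_lt_iff fun j => ?_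
  rw [← YoungDiagram.mem_iff_lt_rowLen, ← YoungDiagram.mem_cells]
  simp only [shrink, Finset.mem_filter, YoungDiagram.mem_cells, YoungDiagram.mem_iff_lt_rowLen,
    Prod.mk_le_mk]
  rcases lt_trichotomy k i with hk | rfl | hk
  · rw [if_neg hk.ne]; omega
  · rw [if_pos rfl]; omega
  · have := μ.rowLen_anti (i + 1) k hk
    rw [if_neg hk.ne']; omega

theorem covBy_of_rowLen {μ ν : YoungDiagram} {i : ℕ}
    (h : ∀ k, ν.rowLen k = μ.rowLen k + if k = i then 1 else 0) : μ ⋖ ν := by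
  have hle : μ ≤ ν := le_iff_rowLen.2 fun k => by rw [h k]; omega
  refine ⟨lt_of_le_not_ge hle fun hge => ?_, fun κ h1 h2 => ?_⟩
  · have h3 := le_iff_rowLen.1 hge i
    rw [h i, if_pos rfl] at h3
    omega
  · have h3 := le_iff_rowLen.1 h1.le
    have h4 := le_iff_rowLen.1 h2.le
    by_cases hi : κ.rowLen i = μ.rowLen i
    · refine h1.not_ge (le_iff_rowLen.2 fun k => ?_)
      have h5 := h4 k
      rw [h k] at h5
      split_ifs at h5 with hk
      · rw [hk, hi]
      · exact h5
    · refine h2.not_ge (le_iff_rowLen.2 fun k => ?_)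
      rw [h k]
      have h5 := h3 k
      split_ifs with hk
      · subst hk; omega
      · exact h5

/-- A cover of Young diagrams adds one cell at the end of a row strictly shorter than the rows
above it. -/
theorem exists_rowLen_of_covBy {μ ν : YoungDiagram} (h : μ ⋖ ν) :
    ∃ i, (∀ k < i, μ.rowLen i < μ.rowLen k) ∧
      ∀ k, ν.rowLen k = μ.rowLen k + if k = i then 1 else 0 := by
  have hle := le_iff_rowLen.1 h.le
  have hex : ∃ i, μ.rowLen i < ν.rowLen i := by
    by_contra! hcon
    exact h.lt.not_ge (le_iff_rowLen.2 hcon)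
  classical
  -- The topmost row in which the two diagrams differ can be extended.
  have hi := Nat.find_spec hex
  have hmin : ∀ k < Nat.find hex, _ := fun k => Nat.find_min hex (m := k)
  set i := Nat.find hex
  have hadd : ∀ k < i, μ.rowLen i < μ.rowLen k := fun k hk => by
    have h1 := hmin k hk
    have h2 := ν.rowLen_anti k i hk.le
    omega
  refine ⟨i, hadd, ?_⟩
  have hcov : μ ⋖ grow μ i := covBy_of_rowLen (rowLen_grow hadd)
  have hgle : grow μ i ≤ ν := le_iff_rowLen.2 fun k => by
    rw [rowLen_grow hadd]
    have := hle k
    split_ifs with hk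
    · subst hk; omega
    · exact this
  have heq : grow μ i = ν := (h.eq_or_eq hcov.le hgle).resolve_left hcov.lt.ne'
  intro k
  rw [← heq, rowLen_grow hadd]

theorem card_of_covBy {μ ν : YoungDiagram} (h : μ ⋖ ν) : ν.card = μ.card + 1 := by
  obtain ⟨i, -, hi⟩ := exists_rowLen_of_covBy h
  have h1 : (i, μ.rowLen i) ∉ μ.cells := by
    rw [YoungDiagram.mem_cells, YoungDiagram.mem_iff_lt_rowLen]; exact lt_irrefl _
  have h2 : ν.cells = insert (i, μ.rowLen i) μ.cells := by
    ext ⟨k, j⟩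
    rw [Finset.mem_insert, YoungDiagram.mem_cells, YoungDiagram.mem_cells,
      YoungDiagram.mem_iff_lt_rowLen, YoungDiagram.mem_iff_lt_rowLen, hi k, Prod.mk.injEq]
    split_ifs with hk
    · subst hk; omega
    · omega
  rw [YoungDiagram.card, h2, Finset.card_insert_of_notMem h1]

theorem eq_grow_of_covBy {μ ν : YoungDiagram} (h : μ ⋖ ν) :
    ∃ i, (∀ k < i, μ.rowLen i < μ.rowLen k) ∧ ν = grow μ i := by
  obtain ⟨i, hadd, hi⟩ := exists_rowLen_of_covBy h
  exact ⟨i, hadd, eq_of_rowLen fun k => by rw [hi, rowLen_grow hadd]⟩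

theorem eq_shrink_of_covBy {μ ν : YoungDiagram} (h : μ ⋖ ν) :
    ∃ i, ν.rowLen (i + 1) < ν.rowLen i ∧ μ = shrink ν i := by
  obtain ⟨i, -, hi⟩ := exists_rowLen_of_covBy h
  have hrem : ν.rowLen (i + 1) < ν.rowLen i := by
    have h1 := μ.rowLen_anti i (i + 1) i.le_succ
    rw [hi i, hi (i + 1), if_pos rfl, if_neg (by omega)]
    omega
  exact ⟨i, hrem, eq_of_rowLen fun k => by rw [rowLen_shrink hrem, hi]; omega⟩

theorem covBy_shrink {μ : YoungDiagram} {i : ℕ} (h : μ.rowLen (i + 1) < μ.rowLen i) :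
    shrink μ i ⋖ μ := by
  refine covBy_of_rowLen (i := i) fun k => ?_
  rw [rowLen_shrink h]
  split_ifs with hk
  · subst hk; omega
  · omega

/-- The skew shape `μ / ν` is a horizontal strip: `ν ⊆ μ`, and no two cells of `μ` outside `ν` lie
in the same column. Equivalently the row lengths interlace,
`μ_0 ≥ ν_0 ≥ μ_1 ≥ ν_1 ≥ ⋯`. -/
def IsHorizontalStrip (μ ν : YoungDiagram) : Prop :=
  ∀ i, ν.rowLen i ≤ μ.rowLen i ∧ μ.rowLen (i + 1) ≤ ν.rowLen i

theorem finite_setOf_card_eq (n : ℕ) : {μ : YoungDiagram | μ.card = n}.Finite := by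
  have hcells : Function.Injective YoungDiagram.cells := fun μ ν h => YoungDiagram.ext h
  refine Set.Finite.of_finite_image (f := YoungDiagram.cells) ?_ hcells.injOn
  refine ((Finset.range n ×ˢ Finset.range n).powerset.finite_toSet).subset ?_
  rintro _ ⟨μ, hμ, rfl⟩
  have hn : μ.cells.card = n := hμ
  simp only [Finset.coe_powerset, Set.mem_preimage, Set.mem_powerset_iff, Finset.coe_subset]
  rintro ⟨i, j⟩ hc
  rw [YoungDiagram.mem_cells] at hc
  have hI : (Finset.Iic i).image (fun k => (k, j)) ⊆ μ.cells := by
    intro c hcm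
    obtain ⟨k, hk, rfl⟩ := Finset.mem_image.1 hcm
    exact μ.up_left_mem (Finset.mem_Iic.1 hk) le_rfl hc
  have hJ : (Finset.Iic j).image (fun k => (i, k)) ⊆ μ.cells := by
    intro c hcm
    obtain ⟨k, hk, rfl⟩ := Finset.mem_image.1 hcm
    exact μ.up_left_mem le_rfl (Finset.mem_Iic.1 hk) hc
  have h1 := Finset.card_le_card hI
  have h2 := Finset.card_le_card hJ
  rw [Finset.card_image_of_injective _ (fun a b h => (Prod.mk.inj h).1), Nat.card_Iic, hn] at h1
  rw [Finset.card_image_of_injective _ (fun a b h => (Prod.mk.inj h).2), Nat.card_Iic, hn] at h2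
  rw [Finset.mem_product, Finset.mem_range, Finset.mem_range]
  exact ⟨h1, h2⟩

/-- The Young diagrams with `n` cells. -/
noncomputable def diagrams (n : ℕ) : Finset YoungDiagram := (finite_setOf_card_eq n).toFinset

theorem mem_diagrams {n : ℕ} {μ : YoungDiagram} : μ ∈ diagrams n ↔ μ.card = n := by
  simp [diagrams]

open Classical in
/-- When `μ / ν` is a horizontal strip, adding a cell to `μ` in row `0` is always possible, and
adding one in row `i + 1` so that the strip stays horizontal is possible exactly when a cell can
be removed from `ν` in row `i` so that the strip stays horizontal. -/
theorem card_strips_of_isHorizontalStrip {μ ν : YoungDiagram} (h : IsHorizontalStrip μ ν) :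
    {κ ∈ diagrams (μ.card + 1) | μ ⋖ κ ∧ IsHorizontalStrip κ ν}.card
      = {ρ ∈ diagrams (ν.card - 1) | IsHorizontalStrip μ ρ ∧ ρ ⋖ ν}.card + 1 := by
  have hfin : {i | μ.rowLen (i + 1) < ν.rowLen i}.Finite := by
    refine (Set.finite_Iio ν.card).subset fun i hi => ?_
    have hmem : (i, 0) ∈ ν := YoungDiagram.mem_iff_lt_rowLen.2 (by
      have : μ.rowLen (i + 1) < ν.rowLen i := hi
      omega)
    have hI : (Finset.Iic i).image (fun k => (k, 0)) ⊆ ν.cells := by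
      intro c hcm
      obtain ⟨k, hk, rfl⟩ := Finset.mem_image.1 hcm
      exact ν.up_left_mem (Finset.mem_Iic.1 hk) le_rfl hmem
    have h1 := Finset.card_le_card hI
    rw [Finset.card_image_of_injective _ (fun a b h => (Prod.mk.inj h).1), Nat.card_Iic] at h1
    exact h1
  set S : Finset ℕ := hfin.toFinset with hS
  have memS : ∀ i, i ∈ S ↔ μ.rowLen (i + 1) < ν.rowLen i := fun i => by simp [hS]
  set S' : Finset ℕ := insert 0 (S.image Nat.succ) with hS'
  have hrem : ∀ i ∈ S, ν.rowLen (i + 1) < ν.rowLen i := fun i hi =>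
    (h (i + 1)).1.trans_lt ((memS i).1 hi)
  have hadd : ∀ i ∈ S', ∀ k < i, μ.rowLen i < μ.rowLen k := by
    intro i hi k hk
    rcases Finset.mem_insert.1 hi with rfl | hi
    · omega
    · obtain ⟨l, hl, rfl⟩ := Finset.mem_image.1 hi
      have h1 := (memS l).1 hl
      have h2 := (h l).1
      have h3 := μ.rowLen_anti k l (by omega)
      simp only [Nat.succ_eq_add_one]
      omega
  have hA : {κ ∈ diagrams (μ.card + 1) | μ ⋖ κ ∧ IsHorizontalStrip κ ν} = S'.image (grow μ) := by
    ext κ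
    simp only [Finset.mem_filter, mem_diagrams, Finset.mem_image]
    constructor
    · rintro ⟨-, hcov, hstrip⟩
      obtain ⟨i, hi, rfl⟩ := eq_grow_of_covBy hcov
      refine ⟨i, ?_, rfl⟩
      rcases i with _ | i
      · exact Finset.mem_insert_self _ _
      · refine Finset.mem_insert_of_mem (Finset.mem_image_of_mem _ ((memS i).2 ?_))
        have h1 := (hstrip i).2
        rw [rowLen_grow hi, if_pos rfl] at h1
        omega
    · rintro ⟨i, hi, rfl⟩
      have hrow := rowLen_grow (hadd i hi)
      have hcov := covBy_of_rowLen hrow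
      refine ⟨card_of_covBy hcov, hcov, fun k => ?_⟩
      have h1 := h k
      rw [hrow, hrow]
      refine ⟨by omega, ?_⟩
      split_ifs with hk
      · subst hk
        rcases Finset.mem_insert.1 hi with h0 | hi
        · omega
        · obtain ⟨l, hl, hlk⟩ := Finset.mem_image.1 hi
          obtain rfl : l = k := by omega
          exact (memS l).1 hl
      · omega
  have hB : {ρ ∈ diagrams (ν.card - 1) | IsHorizontalStrip μ ρ ∧ ρ ⋖ ν} = S.image (shrink ν) := by
    ext ρ
    simp only [Finset.mem_filter, mem_diagrams, Finset.mem_image]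
    constructor
    · rintro ⟨-, hstrip, hcov⟩
      obtain ⟨i, hi, rfl⟩ := eq_shrink_of_covBy hcov
      refine ⟨i, (memS i).2 ?_, rfl⟩
      have h1 := (hstrip i).2
      rw [rowLen_shrink hi, if_pos rfl] at h1
      omega
    · rintro ⟨i, hi, rfl⟩
      have hrow := rowLen_shrink (hrem i hi)
      have hcov := covBy_shrink (hrem i hi)
      have hcard := card_of_covBy hcov
      refine ⟨by omega, fun k => ?_, hcov⟩
      have h1 := h k
      rw [hrow]
      refine ⟨by omega, ?_⟩
      split_ifs with hk
      · subst hk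
        have := (memS k).1 hi
        omega
      · omega
  have hgrow : Set.InjOn (grow μ) S' := by
    intro i hi k hk hik
    have h1 := rowLen_grow (hadd i hi) i
    rw [hik, rowLen_grow (hadd k hk) i, if_pos rfl] at h1
    by_contra hne
    rw [if_neg hne] at h1
    omega
  have hshrink : Set.InjOn (shrink ν) S := by
    intro i hi k hk hik
    have h1 := rowLen_shrink (hrem i hi) i
    have h2 := hrem i hi
    rw [hik, rowLen_shrink (hrem k hk) i, if_pos rfl] at h1
    by_contra hne
    rw [if_neg hne] at h1
    omega
  have h0 : (0 : ℕ) ∉ S.image Nat.succ := by simp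
  rw [hA, hB, Finset.card_image_of_injOn hgrow, Finset.card_image_of_injOn hshrink, hS',
    Finset.card_insert_of_notMem h0, Finset.card_image_of_injective _ Nat.succ_injective]

theorem rowLen_sup (μ ν : YoungDiagram) (i : ℕ) :
    (μ ⊔ ν).rowLen i = max (μ.rowLen i) (ν.rowLen i) :=
  eq_of_forall_lt_iff fun j => by
    rw [← YoungDiagram.mem_iff_lt_rowLen, YoungDiagram.mem_sup, YoungDiagram.mem_iff_lt_rowLen,
      YoungDiagram.mem_iff_lt_rowLen, lt_max_iff]

theorem rowLen_inf (μ ν : YoungDiagram) (i : ℕ) :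
    (μ ⊓ ν).rowLen i = min (μ.rowLen i) (ν.rowLen i) :=
  eq_of_forall_lt_iff fun j => by
    rw [← YoungDiagram.mem_iff_lt_rowLen, YoungDiagram.mem_inf, YoungDiagram.mem_iff_lt_rowLen,
      YoungDiagram.mem_iff_lt_rowLen, lt_min_iff]

/-- A strip that becomes horizontal after adding one cell to `μ`, without being horizontal
itself, forces that cell to turn `μ` into `μ ⊔ ν`. -/
theorem eq_sup_of_not_isHorizontalStrip {μ ν κ : YoungDiagram} (h : ¬ IsHorizontalStrip μ ν)
    (hcov : μ ⋖ κ) (hκ : IsHorizontalStrip κ ν) : κ = μ ⊔ ν ∧ ¬ ν ≤ μ := by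
  have hνμ : ¬ ν ≤ μ := fun hle => h fun i =>
    ⟨le_iff_rowLen.1 hle i, (le_iff_rowLen.1 hcov.le (i + 1)).trans (hκ i).2⟩
  have hνκ : ν ≤ κ := le_iff_rowLen.2 fun i => (hκ i).1
  exact ⟨((hcov.eq_or_eq le_sup_left (sup_le hcov.le hνκ)).resolve_left
    fun h => hνμ (sup_eq_left.1 h)).symm, hνμ⟩

/-- A strip that becomes horizontal after removing one cell from `ν`, without being horizontal
itself, forces that cell to turn `ν` into `μ ⊓ ν`. -/
theorem eq_inf_of_not_isHorizontalStrip {μ ν ρ : YoungDiagram} (h : ¬ IsHorizontalStrip μ ν)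
    (hcov : ρ ⋖ ν) (hρ : IsHorizontalStrip μ ρ) : ρ = μ ⊓ ν ∧ ¬ ν ≤ μ := by
  have hνμ : ¬ ν ≤ μ := fun hle => h fun i =>
    ⟨le_iff_rowLen.1 hle i, (hρ i).2.trans (le_iff_rowLen.1 hcov.le i)⟩
  have hρμ : ρ ≤ μ := le_iff_rowLen.2 fun i => (hρ i).1
  exact ⟨((hcov.eq_or_eq (le_inf hρμ hcov.le) inf_le_right).resolve_right
    fun h => hνμ (inf_eq_right.1 h)).symm, hνμ⟩

open Classical in
theorem card_strips_of_not_isHorizontalStrip {μ ν : YoungDiagram} (h : ¬ IsHorizontalStrip μ ν) :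
    {κ ∈ diagrams (μ.card + 1) | μ ⋖ κ ∧ IsHorizontalStrip κ ν}.card
      = {ρ ∈ diagrams (ν.card - 1) | IsHorizontalStrip μ ρ ∧ ρ ⋖ ν}.card := by
  refine Finset.card_bij' (fun _ _ => μ ⊓ ν) (fun _ _ => μ ⊔ ν) ?_ ?_ ?_ ?_
  · intro κ hκ
    simp only [Finset.mem_filter, mem_diagrams] at hκ ⊢
    obtain ⟨-, hcov, hstrip⟩ := hκ
    obtain ⟨rfl, -⟩ := eq_sup_of_not_isHorizontalStrip h hcov hstrip
    have hcov' : μ ⊓ ν ⋖ ν := IsLowerModularLattice.inf_covBy_of_covBy_sup hcov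
    have hcard := card_of_covBy hcov'
    refine ⟨by omega, fun i => ?_, hcov'⟩
    have h1 := hstrip i
    have h2 := μ.rowLen_anti i (i + 1) i.le_succ
    rw [rowLen_sup, rowLen_sup] at h1
    rw [rowLen_inf]
    omega
  · intro ρ hρ
    simp only [Finset.mem_filter, mem_diagrams] at hρ ⊢
    obtain ⟨-, hstrip, hcov⟩ := hρ
    obtain ⟨rfl, -⟩ := eq_inf_of_not_isHorizontalStrip h hcov hstrip
    have hcov' : μ ⋖ μ ⊔ ν := by
      rw [sup_comm]
      exact IsUpperModularLattice.covBy_sup_of_inf_covBy (inf_comm μ ν ▸ hcov)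
    refine ⟨card_of_covBy hcov', hcov', fun i => ?_⟩
    have h1 := hstrip i
    have h2 := ν.rowLen_anti i (i + 1) i.le_succ
    rw [rowLen_inf] at h1
    rw [rowLen_sup, rowLen_sup]
    omega
  · intro κ hκ
    simp only [Finset.mem_filter, mem_diagrams] at hκ
    exact (eq_sup_of_not_isHorizontalStrip h hκ.2.1 hκ.2.2).1.symm
  · intro ρ hρ
    simp only [Finset.mem_filter, mem_diagrams] at hρ
    exact (eq_inf_of_not_isHorizontalStrip h hρ.2.2 hρ.2.1).1.symm

open Classical in
/-- Adding a cell and removing a horizontal strip commute, up to the strips that absorb the added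
cell: the ways of adding a cell to `μ` and then removing a horizontal strip to reach `ν` exceed
the ways of first removing a horizontal strip and then adding a cell by one if `μ / ν` is a
horizontal strip, and agree in number otherwise. -/
theorem card_strips (μ ν : YoungDiagram) :
    {κ ∈ diagrams (μ.card + 1) | μ ⋖ κ ∧ IsHorizontalStrip κ ν}.card
      = {ρ ∈ diagrams (ν.card - 1) | IsHorizontalStrip μ ρ ∧ ρ ⋖ ν}.card
        + if IsHorizontalStrip μ ν then 1 else 0 := by
  split_ifs with h
  · exact card_strips_of_isHorizontalStrip h
  · exact card_strips_of_not_isHorizontalStrip h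

/-! ### Branching of semistandard tableaux -/

theorem isHorizontalStrip_iff_mem {μ ν : YoungDiagram} :
    IsHorizontalStrip μ ν ↔ ν ≤ μ ∧ ∀ i j, (i + 1, j) ∈ μ → (i, j) ∈ ν := by
  rw [IsHorizontalStrip, forall_and, ← le_iff_rowLen]
  refine and_congr_right fun _ => forall_congr' fun i => ?_
  simp only [YoungDiagram.mem_iff_lt_rowLen]
  exact ⟨fun h j hj => hj.trans_le h, fun h => le_of_not_gt fun hlt => lt_irrefl _ (h _ hlt)⟩

theorem tableauMonomial_apply {μ : YoungDiagram} (T : SemistandardYoungTableau μ) (v : ℕ) :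
    tableauMonomial T v = {c ∈ μ.cells | T c.1 c.2 = v}.card := by
  rw [tableauMonomial, Finsupp.finsetSum_apply, Finset.card_filter]
  exact Finset.sum_congr rfl fun c _ => Finsupp.single_apply

theorem degree_tableauMonomial {μ : YoungDiagram} (T : SemistandardYoungTableau μ) :
    (tableauMonomial T).degree = μ.card := by
  simp [tableauMonomial, map_sum, YoungDiagram.card]

/-- The semistandard tableaux of shape `μ` and content `m`; their number is the Kostka number. -/
noncomputable def tableaux (μ : YoungDiagram) (m : ℕ →₀ ℕ) :
    Finset (SemistandardYoungTableau μ) := (finite_tableaux μ m).toFinset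

theorem mem_tableaux {μ : YoungDiagram} {m : ℕ →₀ ℕ} {T : SemistandardYoungTableau μ} :
    T ∈ tableaux μ m ↔ tableauMonomial T = m := by
  simp [tableaux]

theorem coeff_schur (μ : YoungDiagram) (m : ℕ →₀ ℕ) :
    MvPowerSeries.coeff m (schur μ) = (tableaux μ m).card := by
  rw [tableaux, ← Set.ncard_eq_toFinset_card _ (finite_tableaux μ m)]
  rfl

theorem card_tableaux_eq_zero {μ : YoungDiagram} {m : ℕ →₀ ℕ} (h : μ.card ≠ m.degree) :
    (tableaux μ m).card = 0 := by
  rw [Finset.card_eq_zero, Finset.eq_empty_iff_forall_notMem]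
  intro T hT
  rw [mem_tableaux] at hT
  exact h (hT ▸ (degree_tableauMonomial T).symm)

/-- The shape formed by the cells of `T` with entries smaller than `N`. -/
def shapeBelow {μ : YoungDiagram} (T : SemistandardYoungTableau μ) (N : ℕ) : YoungDiagram where
  cells := {c ∈ μ.cells | T c.1 c.2 < N}
  isLowerSet := by
    rintro ⟨i, j⟩ ⟨k, l⟩ ⟨hki, hlj⟩ ha
    simp only [Finset.coe_filter, Set.mem_ofPred_eq, YoungDiagram.mem_cells] at ha ⊢
    have h1 := T.col_weak hki ha.1
    have h2 := T.row_weak_of_le hlj (μ.up_left_mem hki le_rfl ha.1)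
    exact ⟨μ.up_left_mem hki hlj ha.1, (h2.trans h1).trans_lt ha.2⟩

theorem mem_shapeBelow {μ : YoungDiagram} {T : SemistandardYoungTableau μ} {N i j : ℕ} :
    (i, j) ∈ shapeBelow T N ↔ (i, j) ∈ μ ∧ T i j < N := by
  rw [← YoungDiagram.mem_cells, shapeBelow, Finset.mem_filter, YoungDiagram.mem_cells]

theorem isHorizontalStrip_shapeBelow {μ : YoungDiagram} {T : SemistandardYoungTableau μ} {N : ℕ}
    (h : ∀ i j, (i, j) ∈ μ → T i j ≤ N) : IsHorizontalStrip μ (shapeBelow T N) := by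
  refine isHorizontalStrip_iff_mem.2 ⟨fun c hc => (mem_shapeBelow.1 hc).1, fun i j hij => ?_⟩
  exact mem_shapeBelow.2 ⟨μ.up_left_mem i.le_succ le_rfl hij,
    (T.col_strict i.lt_succ_self hij).trans_le (h _ _ hij)⟩

/-- The restriction of a tableau to a smaller shape. -/
def restrictShape {μ ν : YoungDiagram} (T : SemistandardYoungTableau μ) (h : ν ≤ μ) :
    SemistandardYoungTableau ν where
  entry i j := if (i, j) ∈ ν then T i j else 0
  row_weak' hj hc := by
    rw [if_pos hc, if_pos (ν.up_left_mem le_rfl hj.le hc)]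
    exact T.row_weak hj (h hc)
  col_strict' hi hc := by
    rw [if_pos hc, if_pos (ν.up_left_mem hi.le le_rfl hc)]
    exact T.col_strict hi (h hc)
  zeros' hc := if_neg hc

theorem restrictShape_apply {μ ν : YoungDiagram} (T : SemistandardYoungTableau μ) (h : ν ≤ μ)
    (i j : ℕ) : restrictShape T h i j = if (i, j) ∈ ν then T i j else 0 := rfl

/-- The extension of a tableau with entries smaller than `N` by a horizontal strip filled
with `N`. -/
def extendShape {μ ν : YoungDiagram} (T : SemistandardYoungTableau ν) (N : ℕ)
    (h : IsHorizontalStrip μ ν) (hT : ∀ i j, (i, j) ∈ ν → T i j < N) :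
    SemistandardYoungTableau μ where
  entry i j := if (i, j) ∈ ν then T i j else if (i, j) ∈ μ then N else 0
  row_weak' {i j1 j2} hj hc := by
    have hc1 := μ.up_left_mem le_rfl hj.le hc
    by_cases h2 : (i, j2) ∈ ν
    · rw [if_pos h2, if_pos (ν.up_left_mem le_rfl hj.le h2)]
      exact T.row_weak hj h2
    · rw [if_neg h2, if_pos hc, if_pos hc1]
      split_ifs with h1
      · exact (hT _ _ h1).le
      · exact le_rfl
  col_strict' {i1 i2 j} hi hc := by
    have hc1 : (i1, j) ∈ ν :=
      (isHorizontalStrip_iff_mem.1 h).2 _ _ (μ.up_left_mem hi le_rfl hc)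
    rw [if_pos hc1, if_pos hc]
    split_ifs with h2
    · exact T.col_strict hi h2
    · exact hT _ _ hc1
  zeros' {i j} hc := by
    rw [if_neg fun h1 => hc ((isHorizontalStrip_iff_mem.1 h).1 h1), if_neg hc]

theorem extendShape_apply {μ ν : YoungDiagram} (T : SemistandardYoungTableau ν) (N : ℕ)
    (h : IsHorizontalStrip μ ν) (hT : ∀ i j, (i, j) ∈ ν → T i j < N) (i j : ℕ) :
    extendShape T N h hT i j = if (i, j) ∈ ν then T i j else if (i, j) ∈ μ then N else 0 := rfl

theorem degree_erase_add (m : ℕ →₀ ℕ) (N : ℕ) : (m.erase N).degree + m N = m.degree := by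
  conv_rhs => rw [← Finsupp.erase_add_single N m]
  rw [map_add, Finsupp.degree_single]

theorem eq_of_erase_eq_of_degree_eq {m m' : ℕ →₀ ℕ} {N : ℕ} (h : m.erase N = m'.erase N)
    (hd : m.degree = m'.degree) : m = m' := by
  have h1 := degree_erase_add m N
  have h2 := degree_erase_add m' N
  rw [h] at h1
  rw [← Finsupp.erase_add_single N m, ← Finsupp.erase_add_single N m', h,
    show m N = m' N by omega]

theorem apply_mem_support {μ : YoungDiagram} {m : ℕ →₀ ℕ} {T : SemistandardYoungTableau μ}
    (hT : tableauMonomial T = m) {i j : ℕ} (hc : (i, j) ∈ μ) : T i j ∈ m.support := by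
  rw [Finsupp.mem_support_iff, ← hT, tableauMonomial_apply]
  exact Finset.card_ne_zero_of_mem (Finset.mem_filter.2 ⟨(μ.mem_cells _).2 hc, rfl⟩)

open Classical in
theorem card_tableaux_fiber {μ ν : YoungDiagram} {m : ℕ →₀ ℕ} {N : ℕ}
    (hm : m.support ⊆ Finset.range (N + 1)) (hμ : μ.card = m.degree)
    (h : IsHorizontalStrip μ ν) :
    {T ∈ tableaux μ m | shapeBelow T N = ν}.card = (tableaux ν (m.erase N)).card := by
  have hle := (isHorizontalStrip_iff_mem.1 h).1
  have hlt : ∀ T ∈ tableaux ν (m.erase N), ∀ i j, (i, j) ∈ ν → T i j < N := by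
    intro T hT i j hc
    have h1 := apply_mem_support (mem_tableaux.1 hT) hc
    rw [Finsupp.support_erase, Finset.mem_erase] at h1
    have h2 := Finset.mem_range.1 (hm h1.2)
    omega
  have hN : ∀ T ∈ tableaux μ m, ∀ i j, (i, j) ∈ μ → T i j ≤ N := fun T hT i j hc =>
    Nat.lt_succ_iff.1 (Finset.mem_range.1 (hm (apply_mem_support (mem_tableaux.1 hT) hc)))
  refine Finset.card_bij' (fun T _ => restrictShape T hle)
    (fun T hT => extendShape T N h (hlt T hT)) ?_ ?_ ?_ ?_
  · intro T hT
    rw [Finset.mem_filter] at hT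
    obtain ⟨hT, rfl⟩ := hT
    rw [mem_tableaux]
    ext v
    have hTm := mem_tableaux.1 hT
    rw [Finsupp.erase_apply, tableauMonomial_apply]
    split_ifs with hv
    · rw [Finset.card_eq_zero, Finset.filter_eq_empty_iff]
      rintro ⟨i, j⟩ hc
      rw [YoungDiagram.mem_cells] at hc
      rw [restrictShape_apply, if_pos hc, hv]
      exact (mem_shapeBelow.1 hc).2.ne
    · rw [← hTm, tableauMonomial_apply]
      congr 1
      ext ⟨i, j⟩
      simp only [Finset.mem_filter, YoungDiagram.mem_cells]
      constructor
      · rintro ⟨hc, h1⟩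
        rw [restrictShape_apply, if_pos hc] at h1
        exact ⟨hle hc, h1⟩
      · rintro ⟨hc, h1⟩
        have h2 := hN T hT i j hc
        have h3 : (i, j) ∈ shapeBelow T N := mem_shapeBelow.2 ⟨hc, by omega⟩
        exact ⟨h3, by rw [restrictShape_apply, if_pos h3, h1]⟩
  · intro T hT
    have hlt := hlt T hT
    rw [mem_tableaux] at hT
    rw [Finset.mem_filter, mem_tableaux]
    constructor
    · refine eq_of_erase_eq_of_degree_eq (N := N) ?_ (by rw [degree_tableauMonomial, hμ])
      rw [← hT]
      ext v
      rw [Finsupp.erase_apply, tableauMonomial_apply, tableauMonomial_apply]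
      split_ifs with hv
      · rw [eq_comm, Finset.card_eq_zero, Finset.filter_eq_empty_iff]
        rintro ⟨i, j⟩ hc
        rw [hv]
        exact (hlt i j ((ν.mem_cells _).1 hc)).ne
      · congr 1
        ext ⟨i, j⟩
        rw [Finset.mem_filter, Finset.mem_filter, YoungDiagram.mem_cells, YoungDiagram.mem_cells,
          extendShape_apply]
        constructor
        · rintro ⟨hc, h1⟩
          split_ifs at h1 with h2
          · exact ⟨h2, h1⟩
          · exact absurd h1.symm hv
        · rintro ⟨hc, h1⟩
          exact ⟨hle hc, by rw [if_pos hc, h1]⟩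
    · refine SetLike.ext ?_
      rintro ⟨i, j⟩
      rw [mem_shapeBelow, extendShape_apply]
      constructor
      · rintro ⟨hc, h1⟩
        by_contra hc'
        rw [if_neg hc', if_pos hc] at h1
        exact lt_irrefl _ h1
      · intro hc
        rw [if_pos hc]
        exact ⟨hle hc, hlt i j hc⟩
  · intro T hT
    obtain ⟨hTm, rfl⟩ := Finset.mem_filter.1 hT
    ext i j
    rw [extendShape_apply, restrictShape_apply]
    split_ifs with h1 h2
    · rfl
    · have h3 := hN T hTm i j h2
      have h4 : ¬ T i j < N := fun h => h1 (mem_shapeBelow.2 ⟨h2, h⟩)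
      omega
    · exact (T.zeros h2).symm
  · intro T hT
    ext i j
    rw [restrictShape_apply]
    split_ifs with h1
    · rw [extendShape_apply, if_pos h1]
    · exact (T.zeros h1).symm

open Classical in
/-- The branching rule: a tableau with entries at most `N` is a tableau with entries smaller
than `N` together with a horizontal strip of entries equal to `N`. -/
theorem card_tableaux_eq_sum {μ : YoungDiagram} {m : ℕ →₀ ℕ} {N : ℕ}
    (hm : m.support ⊆ Finset.range (N + 1)) (hμ : μ.card = m.degree) :
    (tableaux μ m).card = ∑ ν ∈ diagrams (m.erase N).degree with IsHorizontalStrip μ ν,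
      (tableaux ν (m.erase N)).card := by
  rw [Finset.card_eq_sum_card_fiberwise (f := fun T => shapeBelow T N)
    (t := {ν ∈ diagrams (m.erase N).degree | IsHorizontalStrip μ ν})]
  · refine Finset.sum_congr rfl fun ν hν => ?_
    exact card_tableaux_fiber hm hμ (Finset.mem_filter.1 hν).2
  · intro T hT
    have hT' : tableauMonomial T = m := mem_tableaux.1 hT
    have hstrip : IsHorizontalStrip μ (shapeBelow T N) := isHorizontalStrip_shapeBelow
      fun i j hc => Nat.lt_succ_iff.1 (Finset.mem_range.1 (hm (apply_mem_support hT' hc)))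
    have hmem : T ∈ {T ∈ tableaux μ m | shapeBelow T N = shapeBelow T N} :=
      Finset.mem_filter.2 ⟨hT, rfl⟩
    have hpos := Finset.card_pos.2 ⟨T, hmem⟩
    have hfib := card_tableaux_fiber hm hμ hstrip
    simp only [Finset.mem_coe, Finset.mem_filter, mem_diagrams]
    refine ⟨?_, hstrip⟩
    by_contra hne
    rw [card_tableaux_eq_zero hne, Finset.card_eq_zero, Finset.eq_empty_iff_forall_notMem] at hfib
    exact hfib T (Finset.mem_filter.2 ⟨hT, rfl⟩)

/-! ### The Pieri rule for one box -/

open Classical in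
/-- The Pieri rule for one box on the level of coefficients, by induction on the number of
variables. -/
theorem sum_card_tableaux_covBy (N : ℕ) (μ : YoungDiagram) (m : ℕ →₀ ℕ)
    (hm : m.support ⊆ Finset.range N) :
    ∑ κ ∈ diagrams (μ.card + 1) with μ ⋖ κ, (tableaux κ m).card
      = ∑ v ∈ m.support, (tableaux μ (m - Finsupp.single v 1)).card := by
  have hdeg : ∀ {m : ℕ →₀ ℕ} {v : ℕ}, v ∈ m.support →
      (m - Finsupp.single v 1).degree + 1 = m.degree := fun {m v} hv => by
    have h1 : Finsupp.single v 1 ≤ m := by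
      rw [Finsupp.single_le_iff]
      exact Nat.one_le_iff_ne_zero.2 (Finsupp.mem_support_iff.1 hv)
    conv_rhs => rw [← tsub_add_cancel_of_le h1]
    rw [map_add, Finsupp.degree_single]
  by_cases hd : m.degree = μ.card + 1
  swap
  · rw [Finset.sum_eq_zero fun κ hκ => card_tableaux_eq_zero ?_,
      Finset.sum_eq_zero fun v hv => card_tableaux_eq_zero ?_]
    · have := hdeg hv
      omega
    · rw [mem_diagrams.1 (Finset.mem_filter.1 hκ).1]
      exact Ne.symm hd
  induction N generalizing μ m with
  | zero =>
    rw [Finset.range_zero, Finset.subset_empty, Finsupp.support_eq_empty] at hm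
    subst hm
    simp at hd
  | succ N ih =>
    set m' := m.erase N with hm'
    have hsupp : m'.support ⊆ Finset.range N := fun v hv => by
      rw [hm', Finsupp.support_erase, Finset.mem_erase] at hv
      have := Finset.mem_range.1 (hm hv.2)
      exact Finset.mem_range.2 (by omega)
    have herase : ∀ v ∈ m'.support,
        (m - Finsupp.single v 1).erase N = m' - Finsupp.single v 1 := fun v hv => by
      have hvN := Finset.mem_range.1 (hsupp hv)
      ext w
      by_cases hw : w = N
      · subst hw
        simp [hm']
      · simp [hm', Finsupp.erase_ne hw]
    -- Both sides are sums over pairs of diagrams; the shape below `N` is the summation index.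
    have hL : ∑ κ ∈ diagrams (μ.card + 1) with μ ⋖ κ, (tableaux κ m).card
        = ∑ ν ∈ diagrams m'.degree,
          {κ ∈ diagrams (μ.card + 1) | μ ⋖ κ ∧ IsHorizontalStrip κ ν}.card
            * (tableaux ν m').card := by
      rw [Finset.sum_congr rfl fun κ hκ => card_tableaux_eq_sum hm
        ((mem_diagrams.1 (Finset.mem_filter.1 hκ).1).trans hd.symm)]
      rw [Finset.sum_comm' (t' := diagrams m'.degree)
        (s' := fun ν => {κ ∈ diagrams (μ.card + 1) | μ ⋖ κ ∧ IsHorizontalStrip κ ν})]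
      · exact Finset.sum_congr rfl fun ν _ => by rw [Finset.sum_const, smul_eq_mul]
      · intro κ ν
        simp only [Finset.mem_filter]
        tauto
    have hR1 : ∑ v ∈ m'.support, (tableaux μ (m - Finsupp.single v 1)).card
        = ∑ ν ∈ diagrams m'.degree,
          {ρ ∈ diagrams (ν.card - 1) | IsHorizontalStrip μ ρ ∧ ρ ⋖ ν}.card
            * (tableaux ν m').card := by
      have hstep : ∀ v ∈ m'.support, (tableaux μ (m - Finsupp.single v 1)).card
          = ∑ ρ ∈ diagrams (m'.degree - 1) with IsHorizontalStrip μ ρ,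
            (tableaux ρ (m' - Finsupp.single v 1)).card := fun v hv => by
        have h1 := hdeg hv
        have hvm : v ∈ m.support := by
          rw [hm', Finsupp.support_erase] at hv
          exact Finset.mem_of_mem_erase hv
        have h2 := hdeg hvm
        have h3 : (m' - Finsupp.single v 1).degree = m'.degree - 1 := by omega
        rw [card_tableaux_eq_sum (N := N) (Finsupp.support_tsub.trans hm) (by omega), herase v hv,
          h3]
      rw [Finset.sum_congr rfl hstep, Finset.sum_comm]
      have hstep2 : ∀ ρ ∈ {ρ ∈ diagrams (m'.degree - 1) | IsHorizontalStrip μ ρ},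
          ∑ v ∈ m'.support, (tableaux ρ (m' - Finsupp.single v 1)).card
            = ∑ ν ∈ diagrams m'.degree with ρ ⋖ ν, (tableaux ν m').card := fun ρ hρ => by
        have h1 := mem_diagrams.1 (Finset.mem_filter.1 hρ).1
        by_cases h0 : m'.degree = 0
        · have hz : m' = 0 := (Finsupp.degree_eq_zero_iff _).1 h0
          rw [Finset.sum_eq_zero (s := {ν ∈ diagrams m'.degree | ρ ⋖ ν}) fun ν hν => ?_]
          · simp [hz]
          · rw [Finset.mem_filter, mem_diagrams] at hν
            have := card_of_covBy hν.2
            omega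
        · rw [← ih ρ m' hsupp (by omega), show ρ.card + 1 = m'.degree by omega]
      rw [Finset.sum_congr rfl hstep2]
      rw [Finset.sum_comm' (t' := diagrams m'.degree)
        (s' := fun ν => {ρ ∈ diagrams (ν.card - 1) | IsHorizontalStrip μ ρ ∧ ρ ⋖ ν})]
      · exact Finset.sum_congr rfl fun ν _ => by rw [Finset.sum_const, smul_eq_mul]
      · intro ρ ν
        simp only [Finset.mem_filter, mem_diagrams]
        constructor
        · rintro ⟨⟨h1, h2⟩, h3, h4⟩
          exact ⟨⟨by omega, h2, h4⟩, h3⟩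
        · rintro ⟨⟨h1, h2, h4⟩, h3⟩
          exact ⟨⟨by omega, h2⟩, h3, h4⟩
    have hR2 : ∑ v ∈ m.support \ m'.support, (tableaux μ (m - Finsupp.single v 1)).card
        = ∑ ν ∈ diagrams m'.degree, (if IsHorizontalStrip μ ν then 1 else 0)
            * (tableaux ν m').card := by
      have hadd := degree_erase_add m N
      rw [← hm'] at hadd
      simp only [ite_mul, one_mul, zero_mul]
      rw [← Finset.sum_filter]
      by_cases hN : N ∈ m.support
      · have hsd : m.support \ m'.support = {N} := by
          rw [hm', Finsupp.support_erase, Finset.sdiff_erase hN, Finset.sdiff_self]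
          rfl
        have h2 := hdeg hN
        rw [hsd, Finset.sum_singleton,
          card_tableaux_eq_sum (N := N) (Finsupp.support_tsub.trans hm) (by omega)]
        have he : (m - Finsupp.single N 1).erase N = m' := by
          ext w
          by_cases hw : w = N
          · subst hw; simp [hm']
          · simp [hm', Finsupp.erase_ne hw, Ne.symm hw]
        rw [he]
      · -- If `N` does not occur in `m`, a strip of shape `μ / ν` would have size `-1`.
        have hsd : m.support \ m'.support = ∅ := by
          rw [hm', Finsupp.support_erase, Finset.erase_eq_of_notMem hN, Finset.sdiff_self]
        rw [hsd, Finset.sum_empty, eq_comm]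
        refine Finset.sum_eq_zero fun ν hν => ?_
        rw [Finset.mem_filter, mem_diagrams] at hν
        have h3 : ν.card ≤ μ.card :=
          Finset.card_le_card (isHorizontalStrip_iff_mem.1 hν.2).1
        have h4 := Finsupp.notMem_support_iff.1 hN
        omega
    have hsub : m'.support ⊆ m.support := by
      rw [hm', Finsupp.support_erase]
      exact Finset.erase_subset _ _
    rw [← Finset.sum_sdiff hsub, hR1, hR2, hL, ← Finset.sum_add_distrib]
    refine Finset.sum_congr rfl fun ν _ => ?_
    rw [card_strips, add_mul, add_comm]

open Classical in
theorem coeff_schur_oneBox (m : ℕ →₀ ℕ) :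
    MvPowerSeries.coeff m (schur oneBox) = if ∃ v, m = Finsupp.single v 1 then 1 else 0 := by
  have hcell : ∀ {i j : ℕ}, (i, j) ∈ oneBox ↔ i = 0 ∧ j = 0 := fun {i j} => by
    rw [← YoungDiagram.mem_cells, oneBox, Finset.mem_singleton, Prod.mk.injEq]
  have hmon : ∀ T : SemistandardYoungTableau oneBox,
      tableauMonomial T = Finsupp.single (T 0 0) 1 := fun T => by
    rw [tableauMonomial, show oneBox.cells = {(0, 0)} from rfl, Finset.sum_singleton]
  rw [coeff_schur]
  split_ifs with h
  · obtain ⟨v, rfl⟩ := h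
    let T : SemistandardYoungTableau oneBox :=
      { entry := fun i j => if (i, j) ∈ oneBox then v else 0
        row_weak' := fun hj hc => by have := hcell.1 hc; omega
        col_strict' := fun hi hc => by have := hcell.1 hc; omega
        zeros' := fun hc => if_neg hc }
    have hT : T 0 0 = v :=
      (if_pos (hcell.2 ⟨rfl, rfl⟩) : (if ((0, 0) : ℕ × ℕ) ∈ oneBox then v else 0) = v)
    rw [Nat.cast_eq_one, Finset.card_eq_one]
    refine ⟨T, Finset.eq_singleton_iff_unique_mem.2 ⟨?_, fun T' hT' => ?_⟩⟩
    · rw [mem_tableaux, hmon, hT]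
    · rw [mem_tableaux, hmon] at hT'
      have h1 := Finsupp.single_left_injective one_ne_zero hT'
      ext i j
      by_cases hc : (i, j) ∈ oneBox
      · obtain ⟨rfl, rfl⟩ := hcell.1 hc
        rw [h1, hT]
      · rw [T.zeros hc, T'.zeros hc]
  · rw [Nat.cast_eq_zero, Finset.card_eq_zero, Finset.eq_empty_iff_forall_notMem]
    intro T hT
    exact h ⟨_, (mem_tableaux.1 hT).symm.trans (hmon T)⟩

/-- Multiplication by `s_1` sums the coefficients over all ways of removing one variable from the
monomial. -/
theorem coeff_mul_schur_oneBox (f : Series) (m : ℕ →₀ ℕ) :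
    MvPowerSeries.coeff m (f * schur oneBox)
      = ∑ v ∈ m.support, MvPowerSeries.coeff (m - Finsupp.single v 1) f := by
  classical
  have hle : ∀ v ∈ m.support, Finsupp.single v 1 ≤ m := fun v hv => by
    rw [Finsupp.single_le_iff]
    exact Nat.one_le_iff_ne_zero.2 (Finsupp.mem_support_iff.1 hv)
  rw [MvPowerSeries.coeff_mul]
  have hinj : Set.InjOn (fun v => (m - Finsupp.single v 1, Finsupp.single v 1))
      (m.support : Set ℕ) := fun v _ w _ h =>
    Finsupp.single_left_injective one_ne_zero (Prod.mk.inj h).2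
  rw [← Finset.sum_subset
    (s₁ := m.support.image fun v => (m - Finsupp.single v 1, Finsupp.single v 1))]
  · rw [Finset.sum_image hinj]
    refine Finset.sum_congr rfl fun v _ => ?_
    rw [coeff_schur_oneBox, if_pos ⟨v, rfl⟩, mul_one]
  · intro p hp
    obtain ⟨v, hv, rfl⟩ := Finset.mem_image.1 hp
    rw [Finset.HasAntidiagonal.mem_antidiagonal]
    exact tsub_add_cancel_of_le (hle v hv)
  · rintro ⟨p, q⟩ hp hpn
    rw [Finset.HasAntidiagonal.mem_antidiagonal] at hp
    simp only at hp ⊢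
    rw [coeff_schur_oneBox, if_neg, mul_zero]
    rintro ⟨v, rfl⟩
    refine hpn (Finset.mem_image.2 ⟨v, ?_, ?_⟩)
    · rw [Finsupp.mem_support_iff, ← hp, Finsupp.add_apply, Finsupp.single_eq_same]
      omega
    · rw [← hp, add_tsub_cancel_right]

open Classical in
/-- The Pieri rule for one box: `s_μ s_1` is the sum of `s_κ` over the diagrams `κ` obtained from
`μ` by adding a cell. -/
theorem schur_mul_schur_oneBox (μ : YoungDiagram) :
    schur μ * schur oneBox = ∑ κ ∈ diagrams (μ.card + 1) with μ ⋖ κ, schur κ := by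
  ext m
  obtain ⟨N, hN⟩ := m.support.exists_nat_subset_range
  rw [coeff_mul_schur_oneBox, map_sum]
  simp only [coeff_schur]
  exact_mod_cast (sum_card_tableaux_covBy N μ m hN).symm

/-- Multiplication by `s_1` preserves nonnegative Schur expansions. -/
theorem exists_nonneg_expansion_mul_schur_oneBox (c : YoungDiagram →₀ ℚ) (hc : ∀ μ, 0 ≤ c μ) :
    ∃ d : YoungDiagram →₀ ℚ, (∀ μ, 0 ≤ d μ) ∧
      (c.sum fun μ a => a • schur μ) * schur oneBox = d.sum fun μ a => a • schur μ := by
  classical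
  refine ⟨∑ μ ∈ c.support, ∑ κ ∈ diagrams (μ.card + 1) with μ ⋖ κ, Finsupp.single κ (c μ),
    fun μ => ?_, ?_⟩
  · rw [Finsupp.finsetSum_apply]
    refine Finset.sum_nonneg fun ν _ => ?_
    rw [Finsupp.finsetSum_apply]
    refine Finset.sum_nonneg fun κ _ => ?_
    rw [Finsupp.single_apply]
    split_ifs
    · exact hc ν
    · exact le_rfl
  · have hlin : ∀ d : YoungDiagram →₀ ℚ,
        (d.sum fun μ a => a • schur μ) = Finsupp.linearCombination ℚ schur d := fun d => rfl
    rw [hlin c, hlin, map_sum, Finsupp.linearCombination_apply, Finsupp.sum,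
      Finset.sum_mul]
    refine Finset.sum_congr rfl fun μ _ => ?_
    rw [smul_mul_assoc, schur_mul_schur_oneBox, map_sum, Finset.smul_sum]
    exact Finset.sum_congr rfl fun κ _ => by rw [Finsupp.linearCombination_single]

/-! ### Coefficients of `Q B` -/

theorem toMultiset_seqMonomial {n : ℕ} (i : Fin n → ℕ) :
    Finsupp.toMultiset (seqMonomial i) = (List.ofFn i : Multiset ℕ) := by
  rw [seqMonomial, map_sum, ← Fin.univ_val_map]
  simp only [Finsupp.toMultiset_single, one_smul]
  exact (congrArg Multiset.sum (Multiset.map_map (fun v : ℕ => ({v} : Multiset ℕ)) i _)).symm.trans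
    (Multiset.sum_map_singleton _)

theorem degree_seqMonomial {n : ℕ} (i : Fin n → ℕ) : (seqMonomial i).degree = n := by
  simp [seqMonomial, map_sum]

theorem mapDomain_seqMonomial {n : ℕ} (τ : ℕ → ℕ) (i : Fin n → ℕ) :
    (seqMonomial i).mapDomain τ = seqMonomial (τ ∘ i) := by
  simp [seqMonomial, Finsupp.mapDomain_finsetSum, Finsupp.mapDomain_single]

theorem eq_of_seqMonomial_eq {n : ℕ} {i j : Fin n → ℕ} (hi : Monotone i) (hj : Monotone j)
    (h : seqMonomial i = seqMonomial j) : i = j := by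
  have h1 := congrArg Finsupp.toMultiset h
  rw [toMultiset_seqMonomial, toMultiset_seqMonomial, Multiset.coe_eq_coe] at h1
  refine List.ofFn_injective (List.Perm.eq_of_pairwise (le := (· ≤ ·))
    (fun a b _ _ => le_antisymm) ?_ ?_ h1)
  · exact List.pairwise_ofFn.2 fun a b hab => hi hab.le
  · exact List.pairwise_ofFn.2 fun a b hab => hj hab.le

theorem exists_monotone_seqMonomial_eq (m : ℕ →₀ ℕ) :
    ∃ i : Fin m.degree → ℕ, Monotone i ∧ seqMonomial i = m := by
  set l := (Finsupp.toMultiset m).sort (· ≤ ·) with hl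
  have hsorted : l.Pairwise (· ≤ ·) := Multiset.pairwise_sort _ _
  have hcoe : (l : Multiset ℕ) = Finsupp.toMultiset m := Multiset.sort_eq _ _
  have hlen : l.length = m.degree := by
    rw [← Multiset.coe_card, hcoe, Finsupp.card_toMultiset, Finsupp.degree_apply]
    rfl
  rw [← hlen]
  refine ⟨l.get, fun a b hab => ?_, ?_⟩
  · rcases hab.lt_or_eq with h | rfl
    · exact List.pairwise_iff_get.1 hsorted a b h
    · exact le_rfl
  · refine Finsupp.orderIsoMultiset.injective ?_
    change Finsupp.toMultiset _ = Finsupp.toMultiset _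
    rw [toMultiset_seqMonomial, List.ofFn_get, hcoe]

/-- `π` is increasing along each set of positions on which the sequence `i` is constant. -/
def IsIncreasingOnFibers {n : ℕ} (i : Fin n → ℕ) (π : Equiv.Perm (Fin n)) : Prop :=
  ∀ a b, a < b → i a = i b → π a < π b

theorem isIncreasingOnFibers_comp_iff {n : ℕ} {τ : ℕ → ℕ} (hτ : Function.Injective τ)
    {i : Fin n → ℕ} {π : Equiv.Perm (Fin n)} :
    IsIncreasingOnFibers (τ ∘ i) π ↔ IsIncreasingOnFibers i π := by
  simp only [IsIncreasingOnFibers, Function.comp_apply, hτ.eq_iff]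

theorem mem_admissibleSeqs_iff {n : ℕ} {i : Fin n → ℕ} (hi : Monotone i)
    (π : Equiv.Perm (Fin n)) :
    i ∈ admissibleSeqs n (Des π) ↔ IsIncreasingOnFibers i π := by
  constructor
  · rintro ⟨-, h⟩ a b
    have key : ∀ d : ℕ, ∀ hb : (a : ℕ) + d + 1 < n,
        i a = i ⟨a + d + 1, hb⟩ → π a < π ⟨a + d + 1, hb⟩ := by
      have hadj : ∀ x y : Fin n, (y : ℕ) = x + 1 → i x = i y → π x < π y := by
        intro x y hxy hixy
        by_contra hlt
        have hne : π y ≠ π x := fun he => by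
          have := congrArg Fin.val (π.injective he)
          omega
        have hgt : π x > π y := lt_of_le_of_ne (not_lt.1 hlt) hne
        refine (h x y hxy ?_).ne hixy
        rw [Des, Finset.mem_filter, Finset.mem_Icc]
        exact ⟨by omega, x, y, hxy.symm, rfl, hgt⟩
      intro d
      induction d with
      | zero => exact fun hb hab => hadj _ _ rfl hab
      | succ d ih =>
        intro hb hab
        have h1 : i a ≤ i ⟨a + d + 1, by omega⟩ := hi (Fin.le_def.2 (by simp only; omega))
        have h2 : i ⟨a + d + 1, by omega⟩ ≤ i ⟨a + (d + 1) + 1, hb⟩ :=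
          hi (Fin.le_def.2 (by simp only; omega))
        exact (ih (by omega) (by omega)).trans (hadj _ _ rfl (by omega))
    intro hab hiab
    have hab' : (a : ℕ) < b := hab
    have hb : (⟨a + (b - a - 1) + 1, by omega⟩ : Fin n) = b := Fin.ext (by simp only; omega)
    have := key (b - a - 1) (by omega)
    rw [hb] at this
    exact this hiab
  · refine fun h => ⟨hi, fun a b hab hb => ?_⟩
    have hlt : a < b := Fin.lt_def.2 (by omega)
    refine lt_of_le_of_ne (hi hlt.le) fun he => ?_
    rw [Des, Finset.mem_filter] at hb
    obtain ⟨-, a', b', ha', hb', hgt⟩ := hb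
    obtain rfl : b' = b := Fin.ext hb'
    obtain rfl : a' = a := Fin.ext (by omega)
    exact (h a' b' hlt he).not_gt hgt

open Classical in
theorem coeff_fundamental {n : ℕ} {i : Fin n → ℕ} (hi : Monotone i) (D : Finset ℕ) :
    MvPowerSeries.coeff (seqMonomial i) (fundamental n D)
      = if i ∈ admissibleSeqs n D then 1 else 0 := by
  have h1 : MvPowerSeries.coeff (seqMonomial i) (fundamental n D)
      = (({j | j ∈ admissibleSeqs n D ∧ seqMonomial j = seqMonomial i} :
          Set (Fin n → ℕ)).ncard : ℚ) := rfl
  rw [h1]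
  split_ifs with h
  · rw [Nat.cast_eq_one, Set.ncard_eq_one]
    refine ⟨i, Set.eq_singleton_iff_unique_mem.2 ⟨⟨h, rfl⟩, fun j hj => ?_⟩⟩
    exact eq_of_seqMonomial_eq hj.1.1 hi hj.2
  · rw [Nat.cast_eq_zero, Set.ncard_eq_zero (finite_seqs n D _), Set.eq_empty_iff_forall_notMem]
    rintro j ⟨hj, hji⟩
    exact h (eq_of_seqMonomial_eq hj.1 hi hji ▸ hj)

open Classical in
/-- The coefficient of `x_{i_1} ⋯ x_{i_n}` with `i_1 ≤ ⋯ ≤ i_n` in `Q B` counts the permutations in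
`B` that increase along each block of equal indices. -/
theorem coeff_Q {n : ℕ} (B : Finset (Equiv.Perm (Fin n))) {i : Fin n → ℕ} (hi : Monotone i) :
    MvPowerSeries.coeff (seqMonomial i) (Q B)
      = ∑ π ∈ B, if IsIncreasingOnFibers i π then 1 else 0 := by
  rw [Q, map_sum]
  refine Finset.sum_congr rfl fun π _ => ?_
  simp only [coeff_fundamental hi, mem_admissibleSeqs_iff hi]

theorem coeff_Q_eq_zero {n : ℕ} (B : Finset (Equiv.Perm (Fin n))) {m : ℕ →₀ ℕ}
    (h : m.degree ≠ n) : MvPowerSeries.coeff m (Q B) = 0 := by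
  rw [Q, map_sum]
  refine Finset.sum_eq_zero fun π _ => ?_
  have h1 : MvPowerSeries.coeff m (fundamental n (Des π))
      = (({j | j ∈ admissibleSeqs n (Des π) ∧ seqMonomial j = m} : Set (Fin n → ℕ)).ncard : ℚ) :=
    rfl
  rw [h1, Nat.cast_eq_zero, Set.ncard_eq_zero (finite_seqs n _ _), Set.eq_empty_iff_forall_notMem]
  rintro j ⟨-, hj⟩
  exact h (hj ▸ degree_seqMonomial j)

open Classical in
/-- If `Q B` is symmetric, its coefficients can be read off along any sequence of indices that
becomes weakly increasing after renaming the variables. -/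
theorem coeff_Q_of_monotone_comp {n : ℕ} {B : Finset (Equiv.Perm (Fin n))}
    (hB : IsSymmetricFunction (Q B)) {i : Fin n → ℕ} (τ : Equiv.Perm ℕ)
    (hi : Monotone (τ ∘ i)) :
    MvPowerSeries.coeff (seqMonomial i) (Q B)
      = ∑ π ∈ B, if IsIncreasingOnFibers i π then 1 else 0 := by
  rw [← hB.2 τ, mapDomain_seqMonomial, coeff_Q B hi]
  simp only [isIncreasingOnFibers_comp_iff τ.injective]

/-! ### Rotations of words -/

/-- The power of the long cycle that moves position `p` to the last position. -/
def rotTo {n : ℕ} (p : Fin (n + 1)) : Equiv.Perm (Fin (n + 1)) := finRotate (n + 1) ^ (n - p : ℕ)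

theorem finRotate_pow_val {n : ℕ} (k : ℕ) (a : Fin (n + 1)) :
    ((finRotate (n + 1) ^ k) a : ℕ) = (a + k) % (n + 1) := by
  induction k with
  | zero => simp [Nat.mod_eq_of_lt a.2]
  | succ k ih =>
    rw [pow_succ', Equiv.Perm.mul_apply, finRotate_apply, Fin.val_add, ih, Fin.val_one',
      ← Nat.add_mod]
    rfl

theorem rotTo_of_le {n : ℕ} {p a : Fin (n + 1)} (h : a ≤ p) :
    (rotTo p a : ℕ) = a + (n - p) := by
  have h1 : (a : ℕ) ≤ p := h
  rw [rotTo, finRotate_pow_val, Nat.mod_eq_of_lt (by omega)]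

theorem rotTo_of_gt {n : ℕ} {p a : Fin (n + 1)} (h : p < a) :
    (rotTo p a : ℕ) = a - p - 1 := by
  have h1 : (p : ℕ) < a := h
  rw [rotTo, finRotate_pow_val, Nat.mod_eq_sub_mod (by omega), Nat.mod_eq_of_lt (by omega)]
  omega

theorem rotTo_self {n : ℕ} (p : Fin (n + 1)) : rotTo p p = Fin.last n :=
  Fin.ext (by rw [rotTo_of_le le_rfl, Fin.val_last]; omega)

theorem cyclicGroup_eq_image_rotTo (n : ℕ) :
    cyclicGroup (n + 1) = Finset.univ.image (rotTo (n := n)) := by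
  ext ρ
  simp only [cyclicGroup, Finset.mem_image, Finset.mem_range, Finset.mem_univ, true_and, rotTo]
  constructor
  · rintro ⟨k, hk, rfl⟩
    exact ⟨⟨n - k, by omega⟩, congrArg _ (by simp only; omega)⟩
  · rintro ⟨p, rfl⟩
    exact ⟨n - p, by omega, rfl⟩

theorem embed_injective {n : ℕ} : Function.Injective (embed (m := n)) := by
  intro σ σ' h
  ext a
  have h1 := congrArg (fun π => (π a.castSucc : ℕ)) h
  simpa only [embed_castSucc, Fin.val_castSucc] using h1

/-- In `embed σ * rotTo p` the largest letter stands at position `p`, so `p` and then `σ` can be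
recovered from it. -/
theorem embed_mul_rotTo_injective {n : ℕ} :
    Function.Injective fun x : Equiv.Perm (Fin n) × Fin (n + 1) => embed x.1 * rotTo x.2 := by
  rintro ⟨σ, p⟩ ⟨σ', p'⟩ h
  simp only at h
  have h1 : (embed σ' * rotTo p') p = (embed σ' * rotTo p') p' := by
    rw [← h, Equiv.Perm.mul_apply, rotTo_self, embed_last, h, Equiv.Perm.mul_apply, rotTo_self,
      embed_last]
  obtain rfl := (embed σ' * rotTo p').injective h1
  exact Prod.ext (embed_injective (mul_right_cancel h)) rfl

theorem sum_rotations {n : ℕ} (A : Finset (Equiv.Perm (Fin n)))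
    (f : Equiv.Perm (Fin (n + 1)) → ℚ) :
    ∑ π ∈ rotations A, f π = ∑ p : Fin (n + 1), ∑ σ ∈ A, f (embed σ * rotTo p) := by
  have h1 : rotations A = (A ×ˢ Finset.univ).image
      fun x : Equiv.Perm (Fin n) × Fin (n + 1) => embed x.1 * rotTo x.2 := by
    ext π
    rw [rotations, cyclicGroup_eq_image_rotTo]
    simp only [Finset.mem_image₂, Finset.mem_image, Finset.mem_product, Finset.mem_univ, true_and,
      and_true, Prod.exists]
    constructor
    · rintro ⟨σ, hσ, _, ⟨p, rfl⟩, rfl⟩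
      exact ⟨σ, p, hσ, rfl⟩
    · rintro ⟨σ, p, hσ, rfl⟩
      exact ⟨σ, hσ, _, ⟨p, rfl⟩, rfl⟩
  rw [h1, Finset.sum_image embed_mul_rotTo_injective.injOn, Finset.sum_product_right]

/-- The index sequence `i_{p+1}, …, i_n, i_0, …, i_{p-1}`: the rotation of `i` that moves position
`p` to the end, with its last entry `i_p` deleted. -/
def rotSeq {n : ℕ} (i : Fin (n + 1) → ℕ) (p : Fin (n + 1)) : Fin n → ℕ :=
  fun a => i ((rotTo p).symm a.castSucc)

theorem seqMonomial_rotSeq {n : ℕ} (i : Fin (n + 1) → ℕ) (p : Fin (n + 1)) :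
    seqMonomial (rotSeq i p) = seqMonomial i - Finsupp.single (i p) 1 := by
  refine eq_tsub_of_add_eq ?_
  have h1 : (rotTo p).symm (Fin.last n) = p := by
    rw [← rotTo_self p, Equiv.symm_apply_apply]
  rw [seqMonomial, seqMonomial,
    ← Equiv.sum_comp (rotTo p).symm fun j => Finsupp.single (i j) 1, Fin.sum_univ_castSucc, h1]
  rfl

/-- A word rotated so that its largest letter stands at `p` increases along the blocks of a
weakly increasing sequence `i` exactly when `p` is the end of a block and the word without its
largest letter increases along the blocks of the correspondingly rotated sequence. -/
theorem isIncreasingOnFibers_embed_mul_rotTo_iff {n : ℕ} {i : Fin (n + 1) → ℕ} (hi : Monotone i)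
    (σ : Equiv.Perm (Fin n)) (p : Fin (n + 1)) :
    IsIncreasingOnFibers i (embed σ * rotTo p) ↔
      (∀ b, p < b → i b ≠ i p) ∧ IsIncreasingOnFibers (rotSeq i p) σ := by
  have hp : (embed σ * rotTo p) p = Fin.last n := by
    rw [Equiv.Perm.mul_apply, rotTo_self, embed_last]
  have hlast : (∀ b, p < b → i b ≠ i p) → ∀ a b, a ≤ p → p < b → i a ≠ i b := by
    intro h a b ha hb hab
    have h1 := hi ha
    have h2 := hi hb.le
    exact h b hb (by omega)
  constructor
  · intro h
    have hend : ∀ b, p < b → i b ≠ i p := fun b hb hib => by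
      have h1 := h p b hb hib.symm
      rw [hp] at h1
      exact h1.not_ge (Fin.le_last _)
    refine ⟨hend, fun a b hab hiab => ?_⟩
    obtain ⟨x, hx⟩ : ∃ x, rotTo p x = a.castSucc := (rotTo p).surjective _
    obtain ⟨y, hy⟩ : ∃ y, rotTo p y = b.castSucc := (rotTo p).surjective _
    rw [rotSeq, rotSeq, ← hx, ← hy, Equiv.symm_apply_apply, Equiv.symm_apply_apply] at hiab
    have hab' : (rotTo p x : ℕ) < rotTo p y := by rw [hx, hy]; exact hab
    have hxy : x < y := by
      rw [Fin.lt_def]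
      rcases le_or_gt x p with h1 | h1 <;> rcases le_or_gt y p with h2 | h2
      · rw [rotTo_of_le h1, rotTo_of_le h2] at hab'
        omega
      · exact absurd hiab (hlast hend x y h1 h2)
      · exact absurd hiab.symm (hlast hend y x h2 h1)
      · rw [rotTo_of_gt h1, rotTo_of_gt h2] at hab'
        omega
    have h3 := h x y hxy hiab
    rwa [Equiv.Perm.mul_apply, Equiv.Perm.mul_apply, hx, hy, embed_castSucc, embed_castSucc,
      Fin.castSucc_lt_castSucc_iff] at h3
  · rintro ⟨hend, h⟩ x y hxy hixy
    have hxp : x ≠ p := by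
      rintro rfl
      exact hend y hxy hixy.symm
    have hne : ∀ z, z ≠ p → ∃ a : Fin n, rotTo p z = a.castSucc := fun z hz => by
      have h1 : rotTo p z ≠ Fin.last n := fun h1 =>
        hz ((rotTo p).injective (h1.trans (rotTo_self p).symm))
      exact ⟨_, (Fin.castSucc_castPred _ h1).symm⟩
    obtain ⟨a, ha⟩ := hne x hxp
    by_cases hyp : y = p
    · rw [hyp, hp, Equiv.Perm.mul_apply, ha, embed_castSucc]
      exact Fin.castSucc_lt_last _
    · obtain ⟨b, hb⟩ := hne y hyp
      have hab : (rotTo p x : ℕ) < rotTo p y := by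
        have hxy' : (x : ℕ) < y := hxy
        rcases le_or_gt x p with h1 | h1 <;> rcases le_or_gt y p with h2 | h2
        · rw [rotTo_of_le h1, rotTo_of_le h2]
          omega
        · exact absurd hixy (hlast hend x y h1 h2)
        · exact absurd (hxy.trans_le h2) h1.not_gt
        · have h1' : (p : ℕ) < x := h1
          rw [rotTo_of_gt h1, rotTo_of_gt h2]
          omega
      rw [ha, hb] at hab
      rw [Equiv.Perm.mul_apply, Equiv.Perm.mul_apply, ha, hb, embed_castSucc, embed_castSucc,
        Fin.castSucc_lt_castSucc_iff]
      refine h a b hab ?_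
      rw [rotSeq, rotSeq, ← ha, ← hb, Equiv.symm_apply_apply, Equiv.symm_apply_apply, hixy]

/-- The permutation of the variables that rotates `0, …, L` so that `v + 1, …, L` come before
`0, …, v`. -/
def rotateVars (v L : ℕ) (h : v ≤ L) : Equiv.Perm ℕ where
  toFun x := if x ≤ v then x + (L - v) else if x ≤ L then x - v - 1 else x
  invFun y := if y < L - v then y + v + 1 else if y ≤ L then y - (L - v) else y
  left_inv x := by
    simp only
    split_ifs <;> omega
  right_inv y := by
    simp only
    split_ifs <;> omega

theorem monotone_rotateVars_comp_rotSeq {n : ℕ} {i : Fin (n + 1) → ℕ} (hi : Monotone i)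
    {p : Fin (n + 1)} (hp : ∀ b, p < b → i b ≠ i p) :
    Monotone (rotateVars (i p) (i (Fin.last n)) (hi (Fin.le_last p)) ∘ rotSeq i p) := by
  intro a b hab
  obtain ⟨x, hx⟩ : ∃ x, rotTo p x = a.castSucc := (rotTo p).surjective _
  obtain ⟨y, hy⟩ : ∃ y, rotTo p y = b.castSucc := (rotTo p).surjective _
  have hab' : (rotTo p x : ℕ) ≤ rotTo p y := by rw [hx, hy]; exact hab
  have hle : ∀ z, z ≤ p → i z ≤ i p := fun z hz => hi hz
  have hgt : ∀ z, p < z → i p < i z := fun z hz => lt_of_le_of_ne (hi hz.le) (hp z hz).symm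
  have hL : ∀ z, i z ≤ i (Fin.last n) := fun z => hi (Fin.le_last z)
  have hval : rotateVars (i p) (i (Fin.last n)) (hi (Fin.le_last p)) (i x)
      ≤ rotateVars (i p) (i (Fin.last n)) (hi (Fin.le_last p)) (i y) := by
    change (if i x ≤ i p then _ else if _ then _ else _)
      ≤ (if i y ≤ i p then _ else if _ then _ else _)
    have hLx := hL x
    have hLy := hL y
    rcases le_or_gt x p with h1 | h1 <;> rcases le_or_gt y p with h2 | h2
    · rw [rotTo_of_le h1, rotTo_of_le h2] at hab'
      have := hi (Fin.le_def.2 (by omega) : x ≤ y)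
      rw [if_pos (hle x h1), if_pos (hle y h2)]
      omega
    · rw [rotTo_of_le h1, rotTo_of_gt h2] at hab'
      have := y.2
      have : (p : ℕ) < y := h2
      omega
    · have := hgt x h1
      rw [if_neg (by omega), if_pos (hL x), if_pos (hle y h2)]
      omega
    · rw [rotTo_of_gt h1, rotTo_of_gt h2] at hab'
      have h1' : (p : ℕ) < x := h1
      have := hi (Fin.le_def.2 (by omega) : x ≤ y)
      have := hgt x h1
      have := hgt y h2
      rw [if_neg (by omega), if_pos (hL x), if_neg (by omega), if_pos (hL y)]
      omega
  rw [Function.comp_apply, Function.comp_apply, rotSeq, rotSeq, ← hx, ← hy,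
    Equiv.symm_apply_apply, Equiv.symm_apply_apply]
  exact hval

theorem mem_support_seqMonomial {n : ℕ} {i : Fin n → ℕ} {v : ℕ} :
    v ∈ (seqMonomial i).support ↔ ∃ a, i a = v := by
  rw [← Finsupp.mem_toMultiset, toMultiset_seqMonomial, Multiset.mem_coe, List.mem_ofFn]

/-- If `Q A` is symmetric, then `Q (A C_n) = Q A · s_1`. -/
theorem Q_rotations {n : ℕ} {A : Finset (Equiv.Perm (Fin n))} (hA : IsSymmetricFunction (Q A)) :
    Q (rotations A) = Q A * schur oneBox := by
  classical
  ext m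
  rw [coeff_mul_schur_oneBox]
  by_cases hm : m.degree = n + 1
  swap
  · rw [coeff_Q_eq_zero _ hm, eq_comm]
    refine Finset.sum_eq_zero fun v hv => coeff_Q_eq_zero _ fun hd => hm ?_
    have h1 : Finsupp.single v 1 ≤ m := by
      rw [Finsupp.single_le_iff]
      exact Nat.one_le_iff_ne_zero.2 (Finsupp.mem_support_iff.1 hv)
    rw [← tsub_add_cancel_of_le h1, map_add, Finsupp.degree_single, hd]
  obtain ⟨i, hi, him⟩ : ∃ i : Fin (n + 1) → ℕ, Monotone i ∧ seqMonomial i = m :=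
    hm ▸ exists_monotone_seqMonomial_eq m
  subst him
  rw [coeff_Q _ hi, sum_rotations]
  -- Only the ends `p` of the blocks of `i` contribute; they correspond to the values of `i`.
  have hterm : ∀ p : Fin (n + 1),
      (∑ σ ∈ A, if IsIncreasingOnFibers i (embed σ * rotTo p) then (1 : ℚ) else 0)
        = if ∀ b, p < b → i b ≠ i p then
            MvPowerSeries.coeff (seqMonomial i - Finsupp.single (i p) 1) (Q A) else 0 := by
    intro p
    simp only [isIncreasingOnFibers_embed_mul_rotTo_iff hi]
    split_ifs with hp
    · rw [← seqMonomial_rotSeq,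
        coeff_Q_of_monotone_comp hA _ (monotone_rotateVars_comp_rotSeq hi hp)]
      exact Finset.sum_congr rfl fun σ _ => if_congr (and_iff_right hp) rfl rfl
    · exact Finset.sum_eq_zero fun σ _ => if_neg fun h => hp h.1
  rw [Finset.sum_congr rfl fun p _ => hterm p, ← Finset.sum_filter]
  refine Finset.sum_bij (fun p _ => i p) ?_ ?_ ?_ ?_
  · exact fun p _ => mem_support_seqMonomial.2 ⟨p, rfl⟩
  · intro p hp q hq hpq
    rw [Finset.mem_filter] at hp hq
    rcases lt_trichotomy p q with h | h | h
    · exact absurd hpq.symm (hp.2 q h)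
    · exact h
    · exact absurd hpq (hq.2 p h)
  · intro v hv
    obtain ⟨a, ha⟩ := mem_support_seqMonomial.1 hv
    obtain ⟨p, hp, hmax⟩ := Finset.exists_max_image {b : Fin (n + 1) | i b = v} id
      ⟨a, by simpa using ha⟩
    simp only [Finset.mem_filter, Finset.mem_univ, true_and, id_eq] at hp hmax
    refine ⟨p, ?_, hp⟩
    rw [Finset.mem_filter]
    exact ⟨Finset.mem_univ _, fun b hb hib => (hmax b (hib.trans hp)).not_gt hb⟩
  · exact fun p _ => rfl

/-! ### Symmetry of the product -/

theorem isSymmetricFunction_Q_mul_schur_oneBox {n : ℕ} {A : Finset (Equiv.Perm (Fin n))}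
    (hA : IsSymmetricFunction (Q A)) : IsSymmetricFunction (Q A * schur oneBox) := by
  constructor
  · refine ⟨n + 1, fun m hm => ?_⟩
    rw [← Q_rotations hA] at hm
    by_contra hlt
    exact hm (coeff_Q_eq_zero _ (by omega))
  · intro τ m
    rw [coeff_mul_schur_oneBox, coeff_mul_schur_oneBox,
      Finsupp.mapDomain_support_of_injective τ.injective, Finset.sum_image τ.injective.injOn]
    refine Finset.sum_congr rfl fun v hv => ?_
    have h1 : Finsupp.single v 1 ≤ m := by
      rw [Finsupp.single_le_iff]
      exact Nat.one_le_iff_ne_zero.2 (Finsupp.mem_support_iff.1 hv)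
    rw [← hA.2 τ (m - Finsupp.single v 1)]
    congr 2
    refine tsub_eq_of_eq_add ?_
    rw [← Finsupp.mapDomain_single, ← Finsupp.mapDomain_add, tsub_add_cancel_of_le h1]

end HorizontalRotation

theorem theorem2p1 (m : ℕ) (hm : 2 ≤ m + 1) (A : Finset (Equiv.Perm (Fin m)))
    (hA : HorizontalRotation.SchurPositive A) :
    HorizontalRotation.SchurPositive (HorizontalRotation.rotations A) ∧
      HorizontalRotation.Q (HorizontalRotation.rotations A) =
        HorizontalRotation.Q A * HorizontalRotation.schur HorizontalRotation.oneBox := by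
  obtain ⟨hsymm, c, hc, hexp⟩ := hA
  have hQ := HorizontalRotation.Q_rotations hsymm
  refine ⟨?_, hQ⟩
  rw [HorizontalRotation.SchurPositive, hQ]
  refine ⟨HorizontalRotation.isSymmetricFunction_Q_mul_schur_oneBox hsymm, ?_⟩
  rw [hexp]
  exact HorizontalRotation.exists_nonneg_expansion_mul_schur_oneBox c hc
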